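/- Let $X$ be a reflexive real Banach space with dual $X^*$, and let $A:X\rightrightarrows X^*$ be a maximal monotone operator (monotone, with no proper monotone extension in the sense of graph inclusion) whose domain $D(A)=\{x: Ax\neq\emptyset\}$ satisfies $\operatorname{int} D(A)\neq\emptyset$. Let $D\subset D(A)$ be dense in $D(A)$, and let $\tilde A$ be a selection of $A$, i.e. $\tilde A(y)\in Ay$ for every $y\in D(A)$. For $S\subset X$ and $x\in S$ put $T(x;S)=\overline{\bigcup_{t>0}t^{-1}(S-x)}$; for $x\in D(A)$ and $v\in X$ put $\sigma_{Ax}(v)=\sup\{\langle x^*,v\rangle: x^*\in Ax\}\in(-\infty,+\infty]$; and let $$L(x,v)=\text{w-}\mathop{\mathrm{Limsup}}_{w\to v,\ t\downarrow 0,\ x+tw\in D}\tilde A(x+tw)$$ be the set of all $\xi\in X^*$ for which there are sequences $w_n\to v$ in norm and $t_n\downarrow 0$ $(t_n>0)$ with $x+t_nw_n\in D$ for all $n$ and $\tilde A(x+t_nw_n)\rightharpoonup\xi$ weakly in $X^*$. Then for every $x\in D(A)$ and every $v\in X\setminus\{0\}$: 1. if $v\in\operatorname{int} T(x;\overline{D(A)})$,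 then $L(x,v)\neq\emptyset$ and $\sigma_{Ax}(v)=\langle\xi,v\rangle$ for every $\xi\in L(x,v)$; 2. if $v\in\operatorname{bd} T(x;\overline{D(A)})$, then $$\sigma_{Ax}(v)=\liminf_{w\to v,\ t\downarrow 0,\ x+tw\in D}\langle\tilde A(x+tw),w\rangle$$ as an identity in $(-\infty,+\infty]$; 3. otherwise, $\sigma_{Ax}(v)=+\infty$. -/

import Mathlib

open Filter Topology

/-- A normed space is reflexive if its canonical embedding into the bidual is onto. -/
def IsReflexiveSpace (X : Type*) [NormedAddCommGroup X] [NormedSpace ℝ X] : Prop :=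
  Function.Surjective (NormedSpace.inclusionInDoubleDual ℝ X)

/-- The effective domain of a set-valued operator from `X` to its dual. -/
def operatorDomain {X : Type*} [NormedAddCommGroup X] [NormedSpace ℝ X]
    (A : X → Set (StrongDual ℝ X)) : Set X :=
  {x | (A x).Nonempty}

/-- Monotonicity of a set-valued operator from `X` to its dual. -/
def IsMonotoneOperator {X : Type*} [NormedAddCommGroup X] [NormedSpace ℝ X]
    (A : X → Set (StrongDual ℝ X)) : Prop :=
  ∀ x y : X, ∀ ξ ∈ A x, ∀ η ∈ A y, 0 ≤ (ξ - η) (x - y)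

/-- Maximal monotonicity: monotone, and without a proper monotone extension in the sense of
inclusion of graphs. -/
def IsMaximalMonotone {X : Type*} [NormedAddCommGroup X] [NormedSpace ℝ X]
    (A : X → Set (StrongDual ℝ X)) : Prop :=
  IsMonotoneOperator A ∧
    ∀ B : X → Set (StrongDual ℝ X), IsMonotoneOperator B → (∀ x, A x ⊆ B x) → B = A

/-- A selection picks an element of `A y` at every point `y` of the domain of `A`.
Its values off the domain are irrelevant. -/
def IsSelection {X : Type*} [NormedAddCommGroup X] [NormedSpace ℝ X]
    (A : X → Set (StrongDual ℝ X)) (a : X → StrongDual ℝ X) : Prop :=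
  ∀ y ∈ operatorDomain A, a y ∈ A y

/-- The support function of a set of functionals, with values in the extended reals. -/
noncomputable def supportFun {X : Type*} [NormedAddCommGroup X] [NormedSpace ℝ X]
    (K : Set (StrongDual ℝ X)) (v : X) : EReal :=
  ⨆ ξ ∈ K, ((ξ v : ℝ) : EReal)

/-- The tangent cone of a set `S` at `x`: the closure of the union of the sets `t⁻¹ (S - x)`
over `t > 0`. -/
def convexTangentCone {X : Type*} [NormedAddCommGroup X] [NormedSpace ℝ X]
    (x : X) (S : Set X) : Set X :=
  closure {v | ∃ t : ℝ, 0 < t ∧ ∃ s ∈ S, v = t⁻¹ • (s - x)}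

/-- The filter of pairs `(w, t)` with `w → v`, `t ↓ 0` (through `t > 0`) and `x + t w ∈ D`. -/
def directionFilter {X : Type*} [NormedAddCommGroup X] [NormedSpace ℝ X]
    (D : Set X) (x v : X) : Filter (X × ℝ) :=
  (𝓝 v ×ˢ 𝓝[>] (0 : ℝ)) ⊓ 𝓟 {p | x + p.2 • p.1 ∈ D}

/-- The sequential weak upper limit of `a (x + t w)` as `w → v`, `t ↓ 0`, `x + t w ∈ D`:
all limits, in the weak topology of the dual, of sequences `a (x + tₙ wₙ)` with `wₙ → v`,
`tₙ > 0`, `tₙ → 0` and `x + tₙ wₙ ∈ D`. -/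
def weakLimsup {X : Type*} [NormedAddCommGroup X] [NormedSpace ℝ X]
    (a : X → StrongDual ℝ X) (D : Set X) (x v : X) : Set (StrongDual ℝ X) :=
  {ξ | ∃ (w : ℕ → X) (t : ℕ → ℝ),
    Tendsto w atTop (𝓝 v) ∧ (∀ n, 0 < t n) ∧ Tendsto t atTop (𝓝 0) ∧
    (∀ n, x + t n • w n ∈ D) ∧
    Tendsto (fun n => toWeakSpace ℝ (StrongDual ℝ X) (a (x + t n • w n))) atTop
      (𝓝 (toWeakSpace ℝ (StrongDual ℝ X) ξ))}

/-!
The argument compares three things at a point `x` of the domain: the tangent cone, the values of `A`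
at points `x + t • w` with `t > 0` small, and the elements of `A x`.

The geometric input is that the interior `U` of the domain is convex and that its closure contains
the domain (`IsMaximalMonotone.convex_interior_operatorDomain`,
`IsMaximalMonotone.operatorDomain_subset_closure_interior`). Both follow from the fact that points
strictly between a point of the domain and a point of `U` lie in the domain
(`IsMaximalMonotone.combo_mem_operatorDomain`), which rests on local boundedness on `U`
(`IsMonotoneOperator.exists_norm_le_of_mem_interior`) and a Hahn–Banach separation. Hence the tangent
cone is the closure of the open convex cone of directions from `x` into `U`, and that open cone is its
interior.

If `v` points into `U`, then `A` is bounded on a truncated cone around the ray from `x` along `v`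
(`IsMonotoneOperator.eventually_norm_le`), so reflexivity yields weak limits `ξ` of the selection. By
maximality `ξ ∈ A x`. Monotonicity gives `ζ w ≤ η w` for `ζ ∈ A x` and `η ∈ A (x + t • w)`, so in the
limit `ζ v ≤ ξ v`: the limit `ξ` attains the support function at `v`. If `v` is only in the tangent
cone, the same inequality bounds the lower limit from below, and approximating `v` by the interior
directions `v + s • e` bounds it from above by sublinearity of the support function. If `v` is outside
the tangent cone, a separating functional is normal to the domain at `x`, and `A x` is unbounded along
it.
-/

open Set

/-! ### Functionals with prescribed lower bounds -/

section Dual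

variable {X : Type*} [NormedAddCommGroup X] [NormedSpace ℝ X]

theorem mul_norm_le_of_forall_le (ξ : StrongDual ℝ X) {ρ b : ℝ} (hρ : 0 < ρ)
    (h : ∀ u : X, ‖u‖ ≤ ρ → ξ u ≤ b) : ρ * ‖ξ‖ ≤ b := by
  have hb : 0 ≤ b := by simpa using h 0 (by simpa using hρ.le)
  have key : ‖ξ‖ ≤ b / ρ := by
    refine ContinuousLinearMap.opNorm_le_of_unit_norm (by positivity) fun u hu ↦ ?_
    have h1 := h (ρ • u) (by simp [norm_smul, hu, abs_of_pos hρ])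
    have h2 := h (-(ρ • u)) (by simp [norm_smul, hu, abs_of_pos hρ])
    simp only [map_neg, map_smul, smul_eq_mul] at h1 h2
    rw [Real.norm_eq_abs, abs_le, le_div_iff₀ hρ, neg_le_iff_add_nonneg,
      ← mul_le_mul_iff_right₀ hρ]
    constructor
    · rw [mul_add, mul_div_cancel₀ _ hρ.ne']
      linarith
    · linarith
  rw [le_div_iff₀ hρ] at key
  linarith

theorem apply_le_of_norm_le (ξ : StrongDual ℝ X) {u : X} {C r : ℝ} (hC : ‖ξ‖ ≤ C) (hr : ‖u‖ ≤ r) :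
    ξ u ≤ C * r :=
  (le_abs_self _).trans <| (ξ.le_opNorm u).trans <|
    mul_le_mul hC hr (norm_nonneg _) ((norm_nonneg _).trans hC)

/-- A form of the Mazur–Orlicz theorem: a functional that dominates prescribed values at prescribed
points exists as soon as the averaged values are dominated by a multiple of the norm of the averaged
points. It separates the convex hull of the data from the open cone `M * ‖w‖ < c` in `X × ℝ`. -/
theorem exists_dual_ge_of_convexHull_le {S : Set (X × ℝ)} (hS : S.Nonempty) {M : ℝ}
    (h : ∀ p ∈ convexHull ℝ S, p.2 ≤ M * ‖p.1‖) :
    ∃ ξ : StrongDual ℝ X, ∀ p ∈ S, p.2 ≤ ξ p.1 := by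
  let N := max M 0
  have hN : ∀ p ∈ convexHull ℝ S, p.2 ≤ N * ‖p.1‖ := fun p hp ↦
    (h p hp).trans (mul_le_mul_of_nonneg_right (le_max_left _ _) (norm_nonneg _))
  have hN0 : 0 ≤ N := le_max_right _ _
  -- The open strict epigraph of `N * ‖·‖`, a convex cone because `N` is the positive part of `M`.
  let E : Set (X × ℝ) := {p | N * ‖p.1‖ < p.2}
  have hEo : IsOpen E := isOpen_lt (by fun_prop) (by fun_prop)
  have hEc : Convex ℝ E := by
    rintro ⟨p, s⟩ hp ⟨q, t⟩ hq α β hα hβ hab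
    simp only [E, mem_ofPred_eq, Prod.smul_mk, Prod.mk_add_mk, smul_eq_mul] at hp hq ⊢
    have h1 : ‖α • p + β • q‖ ≤ α * ‖p‖ + β * ‖q‖ := by
      refine (norm_add_le _ _).trans ?_
      simp [norm_smul, abs_of_nonneg hα, abs_of_nonneg hβ]
    rcases hα.eq_or_lt with rfl | hα
    · obtain rfl : β = 1 := by linarith
      simpa using hq
    calc N * ‖α • p + β • q‖ ≤ N * (α * ‖p‖ + β * ‖q‖) := by gcongr
      _ = α * (N * ‖p‖) + β * (N * ‖q‖) := by ring
      _ < α * s + β * t := by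
        have := mul_lt_mul_of_pos_left hp hα
        have := mul_le_mul_of_nonneg_left hq.le hβ
        linarith
  have hdisj : Disjoint E (convexHull ℝ S) := by
    rw [Set.disjoint_left]
    intro p hp hp'
    exact absurd (hN p hp') (not_le.2 hp)
  obtain ⟨f, u, hfE, hfS⟩ := geometric_hahn_banach_open hEc hEo (convex_convexHull ℝ S) hdisj
  have hE_smul : ∀ p ∈ E, ∀ c : ℝ, 0 < c → c • p ∈ E := by
    intro p hp c hc
    simp only [E, mem_ofPred_eq, Prod.smul_fst, Prod.smul_snd, smul_eq_mul, norm_smul,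
      Real.norm_eq_abs, abs_of_pos hc] at hp ⊢
    nlinarith
  -- `E` is a cone, so `f` is nonpositive on it and the separating level is nonnegative.
  have hf_nonpos : ∀ p ∈ E, f p ≤ 0 := by
    intro p hp
    by_contra! hpos
    have := hfE _ (hE_smul p hp ((|u| + 1) / f p) (by positivity))
    rw [map_smul, smul_eq_mul, div_mul_cancel₀ _ hpos.ne'] at this
    linarith [le_abs_self u]
  have h01 : ((0 : X), (1 : ℝ)) ∈ E := by simp [E]
  have hu : 0 ≤ u := by
    by_contra! hneg
    have hlt := hfE _ h01
    have hne : f (0, 1) < 0 := hlt.trans hneg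
    have := hfE _ (hE_smul _ h01 (u / (2 * f (0, 1)))
      (div_pos_of_neg_of_neg hneg (by linarith)))
    rw [map_smul, smul_eq_mul] at this
    have h2 : u / (2 * f (0, 1)) * f (0, 1) = u / 2 := by
      rw [div_mul_eq_mul_div, mul_div_mul_right _ _ hne.ne]
    linarith
  have hsplit : ∀ p : X × ℝ, f p = f (p.1, 0) + p.2 * f (0, 1) := by
    intro p
    rw [← smul_eq_mul, ← map_smul, ← map_add]
    simp
  -- A vertical separating hyperplane is impossible: `f` would vanish, yet `f < u ≤ f` on the two sets.
  have hβ : f (0, 1) < 0 := by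
    refine lt_of_le_of_ne (hf_nonpos _ h01) fun h0 ↦ ?_
    have hz : ∀ w : X, f (w, 0) ≤ 0 := by
      intro w
      have := hf_nonpos (w, N * ‖w‖ + 1) (by simp [E])
      rw [hsplit, h0] at this
      simpa using this
    obtain ⟨p, hp⟩ := hS
    have h1 := hfS p (subset_convexHull ℝ S hp)
    have h2 := hfE _ h01
    rw [hsplit, h0] at h1
    have := hz p.1
    linarith
  refine ⟨(-(f (0, 1))⁻¹) • f.comp (ContinuousLinearMap.inl ℝ X ℝ), fun p hp ↦ ?_⟩
  have h1 := hu.trans (hfS p (subset_convexHull ℝ S hp))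
  rw [hsplit] at h1
  have : p.2 ≤ f (p.1, 0) / (-f (0, 1)) := by
    rw [le_div_iff₀ (by linarith)]
    linarith
  simpa [div_eq_mul_inv, mul_comm, inv_neg] using this

end Dual

/-! ### Weak sequential compactness in the dual of a reflexive space -/

section Weak

variable {X : Type*} [NormedAddCommGroup X] [NormedSpace ℝ X]

theorem IsReflexiveSpace.exists_eval_eq (hX : IsReflexiveSpace X)
    (φ : StrongDual ℝ (StrongDual ℝ X)) : ∃ u : X, ∀ ξ : StrongDual ℝ X, φ ξ = ξ u := by
  obtain ⟨u, rfl⟩ := hX φ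
  exact ⟨u, fun ξ ↦ rfl⟩

theorem IsReflexiveSpace.tendsto_toWeakSpace_iff (hX : IsReflexiveSpace X) {ι : Type*}
    {l : Filter ι} {η : ι → StrongDual ℝ X} {ξ : StrongDual ℝ X} :
    Tendsto (fun n ↦ toWeakSpace ℝ (StrongDual ℝ X) (η n)) l
      (𝓝 (toWeakSpace ℝ (StrongDual ℝ X) ξ)) ↔ ∀ u, Tendsto (fun n ↦ η n u) l (𝓝 (ξ u)) := by
  have hinj : Function.Injective (topDualPairing ℝ (StrongDual ℝ X)).flip := by
    intro ξ ξ' h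
    ext u
    exact congrArg (fun L ↦ L (NormedSpace.inclusionInDoubleDual ℝ X u)) h
  refine (WeakBilin.tendsto_iff_forall_eval_tendsto _ hinj).trans ⟨fun h u ↦ ?_, fun h φ ↦ ?_⟩
  · exact h (NormedSpace.inclusionInDoubleDual ℝ X u)
  · obtain ⟨u, rfl⟩ := hX φ
    exact h u

/-- Countably many evaluations separate the weak-star closed span of a sequence of functionals on a
reflexive space. Membership in that span is expressed by vanishing on the common kernel. -/
theorem IsReflexiveSpace.exists_seq_separating (hX : IsReflexiveSpace X) (η : ℕ → StrongDual ℝ X) :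
    ∃ u : ℕ → X, ∀ ζ : StrongDual ℝ X, (∀ z, (∀ n, η n z = 0) → ζ z = 0) →
      (∀ k, ζ (u k) = 0) → ζ = 0 := by
  let Y : Submodule ℝ (StrongDual ℝ X) := Submodule.span ℝ (range η)
  have hsep : TopologicalSpace.IsSeparable (closure (Y : Set (StrongDual ℝ X))) :=
    ((countable_range η).isSeparable.span (R := ℝ)).closure
  obtain ⟨c, hc, hYc⟩ := hsep
  obtain ⟨q, hq⟩ : ∃ q : ℕ → StrongDual ℝ X, c ⊆ range q := by
    rcases c.eq_empty_or_nonempty with rfl | hne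
    · exact ⟨0, empty_subset _⟩
    · obtain ⟨q, rfl⟩ := hc.exists_eq_range hne
      exact ⟨q, Subset.rfl⟩
  have hu : ∀ k, ∃ u : X, ‖u‖ ≤ 1 ∧ q k u = ‖q k‖ := by
    intro k
    obtain ⟨g, hg1, hg2⟩ := exists_dual_vector'' ℝ (q k)
    obtain ⟨u, rfl⟩ := hX g
    refine ⟨u, ?_, by simpa using hg2⟩
    rw [← (NormedSpace.inclusionInDoubleDualLi ℝ (E := X)).norm_map u]
    exact hg1
  choose u hu1 hu2 using hu
  refine ⟨u, fun ζ hζ hζu ↦ ?_⟩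
  -- Hahn–Banach and reflexivity put `ζ` into the closed span of the sequence.
  have hmem : ζ ∈ closure (Y : Set (StrongDual ℝ X)) := by
    by_contra hnot
    obtain ⟨f, s, hf, hs⟩ := geometric_hahn_banach_closed_point
      (Y.convex.closure) isClosed_closure hnot
    obtain ⟨z, hz⟩ := hX.exists_eval_eq f
    have hs0 : 0 < s := by simpa using hf 0 (subset_closure Y.zero_mem)
    have hYz : ∀ n, η n z = 0 := by
      intro n
      by_contra hne
      have := hf (((s + 1) / η n z) • η n)
        (subset_closure (Y.smul_mem _ (Submodule.subset_span ⟨n, rfl⟩)))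
      rw [map_smul, hz, smul_eq_mul, div_mul_cancel₀ _ hne] at this
      linarith
    have h2 := hζ z hYz
    rw [hz, h2] at hs
    linarith
  by_contra hne
  have hpos : 0 < ‖ζ‖ := norm_pos_iff.2 hne
  obtain ⟨p, hp, hdist⟩ := Metric.mem_closure_iff.1 (hYc hmem) (‖ζ‖ / 4) (by positivity)
  obtain ⟨k, rfl⟩ := hq hp
  rw [dist_eq_norm] at hdist
  have h1 : ‖q k‖ ≤ ‖ζ - q k‖ := by
    have h := (ζ - q k).le_opNorm (u k)
    rw [sub_apply, hζu, hu2, zero_sub, norm_neg, norm_norm] at h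
    exact h.trans (mul_le_of_le_one_right (norm_nonneg _) (hu1 k))
  have h2 : ‖ζ‖ ≤ ‖ζ - q k‖ + ‖q k‖ := by simpa using norm_add_le (ζ - q k) (q k)
  linarith

/-- Bounded sequences in the dual of a reflexive space have weakly convergent subsequences. The
part of the dual ball lying in the weak-star closed span of the sequence is weak-star compact, and it
is metrizable because countably many evaluations separate its points. -/
theorem IsReflexiveSpace.exists_subseq_tendsto_apply (hX : IsReflexiveSpace X)
    (η : ℕ → StrongDual ℝ X) {C : ℝ} (hC : ∀ n, ‖η n‖ ≤ C) :
    ∃ (ξ : StrongDual ℝ X) (φ : ℕ → ℕ), StrictMono φ ∧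
      ∀ u, Tendsto (fun n ↦ η (φ n) u) atTop (𝓝 (ξ u)) := by
  obtain ⟨z, hz⟩ := hX.exists_seq_separating η
  let K : Set (WeakDual ℝ X) :=
    (WeakDual.toStrongDual ⁻¹' Metric.closedBall (0 : StrongDual ℝ X) C) ∩
      {ξ | ∀ u, (∀ n, η n u = 0) → ξ u = 0}
  have hK : IsCompact K := by
    refine (WeakDual.isCompact_closedBall 0 C).inter_right ?_
    simp only [ofPred_forall]
    exact isClosed_iInter fun u ↦ isClosed_iInter fun _ ↦
      isClosed_eq (WeakDual.eval_continuous u) continuous_const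
  have : CompactSpace K := isCompact_iff_compactSpace.1 hK
  have : TopologicalSpace.MetrizableSpace K := by
    refine Metric.PiNatEmbed.TopologicalSpace.MetrizableSpace.of_countable_separating
      (fun k (ξ : K) ↦ ξ.1 (z k))
      (fun k ↦ (WeakDual.eval_continuous (z k)).comp continuous_subtype_val) fun ξ ξ' hne ↦ ?_
    contrapose! hne
    have h0 := hz (WeakDual.toStrongDual (ξ.1 - ξ'.1))
      (fun u hu ↦ by simp [ξ.2.2 u hu, ξ'.2.2 u hu]) (fun k ↦ by simp [hne k])
    rw [map_sub, sub_eq_zero] at h0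
    exact Subtype.ext (WeakDual.toStrongDual.injective h0)
  let s : ℕ → K := fun n ↦ ⟨StrongDual.toWeakDual (η n), by simpa using hC n, fun u hu ↦ hu n⟩
  let _ := TopologicalSpace.metrizableSpaceMetric K
  obtain ⟨ξ, φ, hφ, hlim⟩ := CompactSpace.tendsto_subseq s
  refine ⟨WeakDual.toStrongDual ξ.1, φ, hφ, fun u ↦ ?_⟩
  exact (((WeakDual.eval_continuous u).comp continuous_subtype_val).tendsto ξ).comp hlim

/-- The duality pairing is continuous along (weak-star convergent, norm convergent) pairs of
sequences, since weak-star convergent sequences are bounded. -/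
theorem tendsto_apply_of_forall_tendsto [CompleteSpace X] {η : ℕ → StrongDual ℝ X}
    {ξ : StrongDual ℝ X} {w : ℕ → X} {v : X}
    (hη : ∀ u, Tendsto (fun n ↦ η n u) atTop (𝓝 (ξ u))) (hw : Tendsto w atTop (𝓝 v)) :
    Tendsto (fun n ↦ η n (w n)) atTop (𝓝 (ξ v)) := by
  obtain ⟨C, hC⟩ := banach_steinhaus (g := η) fun u ↦ by
    obtain ⟨c, hc⟩ := (Metric.isBounded_range_of_tendsto _ (hη u)).exists_norm_le
    exact ⟨c, fun n ↦ hc _ ⟨n, rfl⟩⟩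
  have h0 : Tendsto (fun n ↦ η n (w n - v)) atTop (𝓝 0) := by
    refine squeeze_zero_norm (a := fun n ↦ C * ‖w n - v‖)
      (fun n ↦ (η n).le_of_opNorm_le (hC n) _) ?_
    simpa using (tendsto_iff_norm_sub_tendsto_zero.1 hw).const_mul C
  simpa using h0.add (hη v)

end Weak
/-! ### Domains of maximal monotone operators -/

section Monotone

variable {X : Type*} [NormedAddCommGroup X] [NormedSpace ℝ X] {A : X → Set (StrongDual ℝ X)}

/-- Maximality in the form in which it is used: a pair monotonically related to the whole graph
belongs to the graph. -/
theorem IsMaximalMonotone.mem_of_forall_nonneg (hA : IsMaximalMonotone A) {z : X}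
    {ξ : StrongDual ℝ X} (h : ∀ y, ∀ η ∈ A y, 0 ≤ (ξ - η) (z - y)) : ξ ∈ A z := by
  have hB := hA.2 (fun y ↦ A y ∪ {ζ | ζ = ξ ∧ y = z}) ?_ fun y ↦ subset_union_left
  · rw [← hB]
    exact Or.inr ⟨rfl, rfl⟩
  · rintro y y' ζ (hζ | ⟨rfl, rfl⟩) ζ' (hζ' | ⟨rfl, rfl⟩)
    · exact hA.1 y y' ζ hζ ζ' hζ'
    · have := h y ζ hζ
      rwa [← neg_sub ζ, ← neg_sub y, neg_apply, map_neg, neg_neg] at this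
    · exact h y' ζ' hζ'
    · simp

theorem IsMonotoneOperator.apply_sub_le (hA : IsMonotoneOperator A) {x y : X}
    {ξ η : StrongDual ℝ X} (hξ : ξ ∈ A x) (hη : η ∈ A y) : η (x - y) ≤ ξ (x - y) := by
  have := hA x y ξ hξ η hη
  rw [sub_apply] at this
  linarith

/-- Along a ray from `x`, values of a monotone operator in the ray direction dominate those at `x`. -/
theorem IsMonotoneOperator.apply_le_apply_of_smul (hA : IsMonotoneOperator A) {x w : X} {t : ℝ}
    (ht : 0 < t) {ξ η : StrongDual ℝ X} (hξ : ξ ∈ A x) (hη : η ∈ A (x + t • w)) : ξ w ≤ η w := by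
  have h := hA.apply_sub_le hη hξ
  rwa [add_sub_cancel_left, map_smul, map_smul, smul_eq_mul, smul_eq_mul,
    mul_le_mul_iff_right₀ ht] at h

/-- Off the tangent cone the support function is infinite: a functional separating `v` from the cone
is normal to the domain at `x`, hence a recession direction of `A x`. -/
theorem IsMaximalMonotone.supportFun_eq_top (hA : IsMaximalMonotone A) {x v : X}
    (hx : x ∈ operatorDomain A)
    (hconv : Convex ℝ (convexTangentCone x (closure (operatorDomain A))))
    (hv : v ∉ convexTangentCone x (closure (operatorDomain A))) : supportFun (A x) v = ⊤ := by
  obtain ⟨f, u, hf, hu⟩ := geometric_hahn_banach_closed_point hconv isClosed_closure hv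
  obtain ⟨ξ, hξ⟩ := hx
  have hmem : ∀ y ∈ operatorDomain A, ∀ t : ℝ, 0 < t →
      t⁻¹ • (y - x) ∈ convexTangentCone x (closure (operatorDomain A)) := fun y hy t ht ↦
    subset_closure ⟨t, ht, y, subset_closure hy, rfl⟩
  have hu0 : 0 < u := by simpa using hf _ (hmem x ⟨ξ, hξ⟩ 1 one_pos)
  have hnormal : ∀ y ∈ operatorDomain A, f (y - x) ≤ 0 := by
    intro y hy
    by_contra! hpos
    have := hf _ (hmem y hy (f (y - x) / u) (by positivity))
    rw [map_smul, smul_eq_mul, inv_div, div_mul_cancel₀ _ hpos.ne'] at this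
    exact lt_irrefl _ this
  -- The functional `f` is normal to the domain at `x`, so `A x` contains the ray from `ξ` along `f`.
  have hray : ∀ s : ℝ, 0 ≤ s → ξ + s • f ∈ A x := by
    intro s hs
    refine hA.mem_of_forall_nonneg fun y η hη ↦ ?_
    have h1 := hA.1.apply_sub_le hξ hη
    have h2 := mul_nonneg hs (neg_nonneg.2 (hnormal y ⟨η, hη⟩))
    rw [← map_neg, neg_sub] at h2
    simp only [sub_apply, add_apply, smul_apply, smul_eq_mul]
    linarith
  rw [EReal.eq_top_iff_forall_lt]
  intro c
  have hfv : 0 < f v := hu0.trans hu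
  let s : ℝ := (|c - ξ v| + 1) / f v
  have hs : 0 ≤ s := by positivity
  refine lt_of_lt_of_le ?_ (le_iSup₂ (f := fun (ζ : StrongDual ℝ X) (_ : ζ ∈ A x) ↦
    ((ζ v : ℝ) : EReal)) _ (hray s hs))
  rw [EReal.coe_lt_coe_iff, add_apply, smul_apply, smul_eq_mul, div_mul_cancel₀ _ hfv.ne']
  linarith [le_abs_self (c - ξ v)]

/-- Rockafellar's local boundedness theorem. The uniform boundedness principle is applied to the
functionals `(1 + ‖η‖ * ‖y - y₀‖)⁻¹ • η` with `η ∈ A y`; the resulting bound `‖η‖ ≤ C * (1 + ‖η‖ *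
‖y - y₀‖)` can be solved for `‖η‖` once `y` is close to `y₀`. -/
theorem IsMonotoneOperator.exists_norm_le_of_mem_interior [CompleteSpace X]
    (hA : IsMonotoneOperator A) {y₀ : X} (hy₀ : y₀ ∈ interior (operatorDomain A)) :
    ∃ r > 0, ∃ C : ℝ, Metric.ball y₀ r ⊆ operatorDomain A ∧
      ∀ y ∈ Metric.ball y₀ r, ∀ η ∈ A y, ‖η‖ ≤ C := by
  obtain ⟨ρ, hρ, hball⟩ := Metric.mem_nhds_iff.1 (mem_interior_iff_mem_nhds.1 hy₀)
  let ι := {p : X × StrongDual ℝ X // p.2 ∈ A p.1 ∧ ‖p.1 - y₀‖ ≤ 1}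
  let d : ι → ℝ := fun i ↦ 1 + ‖i.1.2‖ * ‖i.1.1 - y₀‖
  have hd : ∀ i, 1 ≤ d i := fun i ↦ by
    have : 0 ≤ ‖i.1.2‖ * ‖i.1.1 - y₀‖ := by positivity
    simp only [d]
    linarith
  -- Monotonicity bounds the rescaled functionals from above at each small vector.
  have hsmall : ∀ u : X, ‖u‖ < ρ → ∃ K, 0 ≤ K ∧ ∀ i : ι, i.1.2 u ≤ K * d i := by
    intro u hu
    obtain ⟨ζ, hζ⟩ := hball (show y₀ + u ∈ Metric.ball y₀ ρ by simpa using hu)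
    refine ⟨‖ζ‖ * (1 + ρ) + 1, by positivity, fun i ↦ ?_⟩
    obtain ⟨⟨y, η⟩, hη, hy⟩ := i
    simp only at hη hy
    have h1 := hA.apply_sub_le hζ hη
    have h2 : ζ (y₀ + u - y) ≤ ‖ζ‖ * (1 + ρ) := by
      refine apply_le_of_norm_le ζ le_rfl ?_
      calc ‖y₀ + u - y‖ = ‖-(y - y₀) + u‖ := by congr 1; abel
        _ ≤ ‖y - y₀‖ + ‖u‖ := (norm_add_le _ _).trans_eq (by rw [norm_neg])
        _ ≤ 1 + ρ := by linarith
    have h3 : η (y - y₀) ≤ ‖η‖ * ‖y - y₀‖ := apply_le_of_norm_le η le_rfl le_rfl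
    have h4 : η (y₀ + u - y) = η u - η (y - y₀) := by rw [← map_sub]; congr 1; abel
    have h5 : 0 ≤ ‖η‖ * ‖y - y₀‖ := by positivity
    have h6 : 0 ≤ ‖ζ‖ * (1 + ρ) := by positivity
    simp only [d]
    nlinarith
  obtain ⟨C, hC⟩ := banach_steinhaus (g := fun i : ι ↦ (d i)⁻¹ • i.1.2) fun u ↦ by
    obtain ⟨c, hc, hcu⟩ : ∃ c : ℝ, 0 < c ∧ ‖c • u‖ < ρ := by
      refine ⟨ρ / (2 * (‖u‖ + 1)), by positivity, ?_⟩
      rw [norm_smul, Real.norm_of_nonneg (by positivity), div_mul_eq_mul_div,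
        div_lt_iff₀ (by positivity)]
      nlinarith [norm_nonneg u]
    obtain ⟨K₁, hK₁, h₁⟩ := hsmall (c • u) hcu
    obtain ⟨K₂, hK₂, h₂⟩ := hsmall (-(c • u)) (by rwa [norm_neg])
    refine ⟨c⁻¹ * (K₁ + K₂), fun i ↦ ?_⟩
    have hdi : 0 < d i := zero_lt_one.trans_le (hd i)
    have h1 := h₁ i
    have h2 := h₂ i
    rw [map_neg] at h2
    rw [map_smul, smul_eq_mul] at h1 h2
    rw [smul_apply, norm_smul, norm_inv, Real.norm_of_nonneg hdi.le,
      inv_mul_le_iff₀ hdi, Real.norm_eq_abs, ← mul_le_mul_iff_right₀ hc]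
    have h3 : c * (d i * (c⁻¹ * (K₁ + K₂))) = d i * (K₁ + K₂) := by field_simp
    have h4 : c * |i.1.2 u| = |c * i.1.2 u| := by rw [abs_mul, abs_of_pos hc]
    rw [h3, h4, abs_le]
    constructor <;> nlinarith
  have hCd : ∀ i : ι, ‖i.1.2‖ ≤ (|C| + 1) * d i := by
    intro i
    have hdi : 0 < d i := zero_lt_one.trans_le (hd i)
    have := hC i
    rw [norm_smul, norm_inv, Real.norm_of_nonneg hdi.le, inv_mul_le_iff₀ hdi] at this
    nlinarith [le_abs_self C]
  have hC1 : 0 < |C| + 1 := by positivity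
  -- On this ball `‖η‖ ≤ (|C| + 1) * (1 + ‖η‖ * ‖y - y₀‖) ≤ (|C| + 1) + ‖η‖ / 2`.
  refine ⟨min ρ (min 1 (1 / (2 * (|C| + 1)))), by positivity, 2 * (|C| + 1),
    (Metric.ball_subset_ball (min_le_left _ _)).trans hball, fun y hy η hη ↦ ?_⟩
  rw [mem_ball_iff_norm, lt_min_iff, lt_min_iff] at hy
  have h1 := hCd ⟨(y, η), hη, hy.2.1.le⟩
  have h2 := hy.2.2
  rw [lt_div_iff₀ (by positivity)] at h2
  simp only [d] at h1
  have h3 := mul_le_mul_of_nonneg_left h2.le (norm_nonneg η)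
  nlinarith

/-- The triples `(z - y, η (z - y), η)` for `η ∈ A y`. The first two components record the value that
an element of `A z` has to dominate at `z - y`; the third one is kept so that monotonicity, an
inequality affine in each of two such triples, passes to convex combinations. -/
def shiftedGraph (A : X → Set (StrongDual ℝ X)) (z : X) : Set (X × ℝ × StrongDual ℝ X) :=
  {g | ∃ y, ∃ η ∈ A y, g = (z - y, η (z - y), η)}

theorem convex_setOf_add_le (g : X × ℝ × StrongDual ℝ X) :
    Convex ℝ {h : X × ℝ × StrongDual ℝ X |
      h.2.1 + g.2.1 ≤ h.2.2 g.1 + g.2.2 h.1} := by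
  rintro ⟨w, c, ξ⟩ h ⟨w', c', ξ'⟩ h' α β hα hβ hab
  simp only [mem_ofPred_eq, Prod.smul_mk, Prod.mk_add_mk, smul_eq_mul,
    add_apply, smul_apply, map_add, map_smul] at h h' ⊢
  have e : g.2.1 = α * g.2.1 + β * g.2.1 := by rw [← add_mul, hab, one_mul]
  have := mul_le_mul_of_nonneg_left h hα
  have := mul_le_mul_of_nonneg_left h' hβ
  rw [e]
  linarith

/-- Monotonicity averaged in both arguments. For `g = h` it says `h.2.1 ≤ h.2.2 h.1`. -/
theorem IsMonotoneOperator.add_le_of_mem_convexHull (hA : IsMonotoneOperator A) {z : X}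
    {g h : X × ℝ × StrongDual ℝ X} (hg : g ∈ convexHull ℝ (shiftedGraph A z))
    (hh : h ∈ convexHull ℝ (shiftedGraph A z)) :
    h.2.1 + g.2.1 ≤ h.2.2 g.1 + g.2.2 h.1 := by
  have key : ∀ g ∈ shiftedGraph A z, ∀ h ∈ convexHull ℝ (shiftedGraph A z),
      h.2.1 + g.2.1 ≤ h.2.2 g.1 + g.2.2 h.1 := by
    intro g hg h hh
    refine convexHull_min ?_ (convex_setOf_add_le g) hh
    obtain ⟨y, η, hη, rfl⟩ := hg
    rintro _ ⟨y', η', hη', rfl⟩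
    have := hA.apply_sub_le hη hη'
    simp only [mem_ofPred_eq, map_sub] at this ⊢
    linarith
  have := convexHull_min (fun g hg ↦ ?_) (convex_setOf_add_le h) hg
  · simp only [mem_ofPred_eq] at this
    linarith
  · have := key g hg h hh
    simp only [mem_ofPred_eq]
    linarith

/-- A point `z ≠ x` of the segment from `x` in the domain to an interior point `y₀` is in the domain. An
element of `A z` is produced by `exists_dual_ge_of_convexHull_le`. Its hypothesis `c ≤ M * ‖w‖` holds
for an averaged triple `(w, c, ξ)` with `‖ξ‖ ≤ M` because `c ≤ ξ w`, and for one with large `‖ξ‖`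
because the averages of monotonicity against `x` and against a ball around `y₀` bound
`c + const * ‖ξ‖` by a multiple of `1 + ‖w‖`. -/
theorem IsMaximalMonotone.combo_mem_operatorDomain [CompleteSpace X] (hA : IsMaximalMonotone A)
    {x y₀ : X} (hx : x ∈ operatorDomain A) (hy₀ : y₀ ∈ interior (operatorDomain A)) {s : ℝ}
    (hs0 : 0 < s) (hs1 : s ≤ 1) : (1 - s) • x + s • y₀ ∈ operatorDomain A := by
  obtain ⟨r, hr, K, hball, hK⟩ := hA.1.exists_norm_le_of_mem_interior hy₀
  obtain ⟨ξx, hξx⟩ := hx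
  set z := (1 - s) • x + s • y₀ with hz
  have hK0 : 0 ≤ K := by
    obtain ⟨η, hη⟩ := hball (Metric.mem_ball_self hr)
    exact (norm_nonneg η).trans (hK _ (Metric.mem_ball_self hr) η hη)
  let K' : ℝ := (‖ξx‖ + K) * (1 + ‖z - x‖ + ‖z - y₀‖ + r)
  have hK' : 0 ≤ K' := by positivity
  have hmain : ∀ h ∈ convexHull ℝ (shiftedGraph A z),
      s * (r / 2) * ‖h.2.2‖ ≤ K' * (1 + ‖h.1‖) - h.2.1 := by
    rintro ⟨w, c, ξ⟩ hh
    simp only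
    rw [mul_comm s, mul_assoc, mul_comm s, ← mul_assoc, ← le_div_iff₀ hs0]
    refine mul_norm_le_of_forall_le ξ (by positivity) fun u hu ↦ ?_
    rw [le_div_iff₀ hs0]
    have hmem : y₀ + u ∈ Metric.ball y₀ r := by
      simp only [mem_ball_iff_norm, add_sub_cancel_left]
      linarith
    obtain ⟨η, hη⟩ := hball hmem
    have h1 := hA.1.add_le_of_mem_convexHull
      (subset_convexHull ℝ _ ⟨x, ξx, hξx, rfl⟩) hh
    have h2 := hA.1.add_le_of_mem_convexHull
      (subset_convexHull ℝ _ ⟨y₀ + u, η, hη, rfl⟩) hh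
    simp only at h1 h2
    have e1 : ξx w - ξx (z - x) ≤ ‖ξx‖ * (‖w‖ + ‖z - x‖) := by
      rw [← map_sub]; exact apply_le_of_norm_le _ le_rfl (norm_sub_le _ _)
    have e2 : η w - η (z - (y₀ + u)) ≤ K * (‖w‖ + (‖z - y₀‖ + r)) := by
      rw [← map_sub]
      refine apply_le_of_norm_le _ (hK _ hmem η hη) ((norm_sub_le _ _).trans ?_)
      rw [← sub_sub]
      have := norm_sub_le (z - y₀) u
      linarith
    -- The weights `1 - s` and `s` cancel everything in `ξ` except the perturbation `u`.
    have e3 : (1 - s) * ξ (z - x) + s * ξ (z - (y₀ + u)) = - (s * ξ u) := by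
      simp only [← smul_eq_mul, ← map_smul, ← map_add, ← map_neg]
      congr 1
      rw [hz]
      module
    have f1 := mul_le_mul_of_nonneg_left h1 (sub_nonneg.2 hs1)
    have f2 := mul_le_mul_of_nonneg_left h2 hs0.le
    have b1 : (1 - s) * (ξx w - ξx (z - x)) ≤ ‖ξx‖ * (‖w‖ + ‖z - x‖) := by
      have : 0 ≤ ‖ξx‖ * (‖w‖ + ‖z - x‖) := by positivity
      nlinarith
    have b2 : s * (η w - η (z - (y₀ + u))) ≤ K * (‖w‖ + (‖z - y₀‖ + r)) := by
      have : 0 ≤ K * (‖w‖ + (‖z - y₀‖ + r)) := by positivity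
      nlinarith
    have b3 : ‖ξx‖ * (‖w‖ + ‖z - x‖) + K * (‖w‖ + (‖z - y₀‖ + r)) ≤ K' * (1 + ‖w‖) := by
      have a1 : ‖w‖ + ‖z - x‖ ≤ (1 + ‖z - x‖ + ‖z - y₀‖ + r) * (1 + ‖w‖) := by
        have p1 : 0 ≤ ‖z - x‖ * ‖w‖ := by positivity
        have p2 : 0 ≤ ‖z - y₀‖ * ‖w‖ := by positivity
        have p3 : 0 ≤ r * ‖w‖ := by positivity
        nlinarith [norm_nonneg (z - y₀)]
      have a2 : ‖w‖ + (‖z - y₀‖ + r) ≤ (1 + ‖z - x‖ + ‖z - y₀‖ + r) * (1 + ‖w‖) := by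
        have p1 : 0 ≤ ‖z - x‖ * ‖w‖ := by positivity
        have p2 : 0 ≤ ‖z - y₀‖ * ‖w‖ := by positivity
        have p3 : 0 ≤ r * ‖w‖ := by positivity
        nlinarith [norm_nonneg (z - x)]
      have := mul_le_mul_of_nonneg_left a1 (norm_nonneg ξx)
      have := mul_le_mul_of_nonneg_left a2 hK0
      simp only [K']
      linarith
    linarith
  -- The first term covers the growth in `‖w‖`; the second makes `s * (r / 2) * M` absorb the constant `K'`.
  let M : ℝ := K' + K' / (s * (r / 2))
  let π : X × ℝ × StrongDual ℝ X →ₗ[ℝ] X × ℝ :=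
    (LinearMap.fst ℝ X (ℝ × StrongDual ℝ X)).prod
      (LinearMap.fst ℝ ℝ (StrongDual ℝ X) ∘ₗ LinearMap.snd ℝ X (ℝ × StrongDual ℝ X))
  obtain ⟨ξ, hξ⟩ := exists_dual_ge_of_convexHull_le (M := M)
    (S := π '' shiftedGraph A z) ⟨_, _, ⟨x, ξx, hξx, rfl⟩, rfl⟩ (by
      intro p hp
      rw [← π.image_convexHull] at hp
      obtain ⟨⟨w, c, ξ⟩, hh, rfl⟩ := hp
      change c ≤ M * ‖w‖
      have h1 := hmain _ hh
      have h2 := hA.1.add_le_of_mem_convexHull hh hh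
      simp only at h1 h2
      have hsr : 0 < s * (r / 2) := by positivity
      have hdiv : 0 ≤ K' / (s * (r / 2)) := by positivity
      rcases le_total ‖ξ‖ M with hM | hM
      · have := apply_le_of_norm_le ξ hM (le_refl ‖w‖)
        linarith
      · have e : s * (r / 2) * M = s * (r / 2) * K' + K' := by simp only [M]; field_simp
        have h3 := mul_le_mul_of_nonneg_left hM hsr.le
        have h4 : 0 ≤ s * (r / 2) * K' := by positivity
        have h5 : K' * ‖w‖ ≤ M * ‖w‖ := by
          refine mul_le_mul_of_nonneg_right ?_ (norm_nonneg _)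
          simp only [M]; linarith
        linarith)
  refine ⟨ξ, hA.mem_of_forall_nonneg fun y η hη ↦ ?_⟩
  have : η (z - y) ≤ ξ (z - y) := hξ _ ⟨_, ⟨y, η, hη, rfl⟩, rfl⟩
  rw [sub_apply]
  linarith

theorem IsMaximalMonotone.combo_mem_interior [CompleteSpace X] (hA : IsMaximalMonotone A)
    {x y₀ : X} (hx : x ∈ operatorDomain A) (hy₀ : y₀ ∈ interior (operatorDomain A)) {s : ℝ}
    (hs0 : 0 < s) (hs1 : s ≤ 1) : (1 - s) • x + s • y₀ ∈ interior (operatorDomain A) := by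
  have ho : IsOpen ((fun y ↦ (1 - s) • x + s • y) '' interior (operatorDomain A)) := by
    have := (isOpenMap_add_left ((1 - s) • x)).comp (isOpenMap_smul₀ hs0.ne')
    exact this _ isOpen_interior
  refine interior_maximal ?_ ho (mem_image_of_mem _ hy₀)
  rintro _ ⟨y, hy, rfl⟩
  exact hA.combo_mem_operatorDomain hx hy hs0 hs1

theorem IsMaximalMonotone.convex_interior_operatorDomain [CompleteSpace X]
    (hA : IsMaximalMonotone A) : Convex ℝ (interior (operatorDomain A)) := by
  intro x hx y hy α β hα hβ hab
  rcases hβ.eq_or_lt with rfl | hβ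
  · obtain rfl : α = 1 := by linarith
    simpa using hx
  · obtain rfl : α = 1 - β := by linarith
    exact hA.combo_mem_interior (interior_subset hx) hy hβ (by linarith)

theorem IsMaximalMonotone.operatorDomain_subset_closure_interior [CompleteSpace X]
    (hA : IsMaximalMonotone A) (hint : (interior (operatorDomain A)).Nonempty) :
    operatorDomain A ⊆ closure (interior (operatorDomain A)) := by
  intro x hx
  obtain ⟨y, hy⟩ := hint
  have hlim : Tendsto (fun s : ℝ ↦ (1 - s) • x + s • y) (𝓝[>] 0) (𝓝 x) := by
    have : Continuous fun s : ℝ ↦ (1 - s) • x + s • y := by fun_prop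
    simpa using (this.tendsto 0).mono_left nhdsWithin_le_nhds
  refine mem_closure_of_tendsto hlim ?_
  filter_upwards [Ioc_mem_nhdsGT (zero_lt_one' ℝ)] with s hs
  exact hA.combo_mem_interior hx hy hs.1 hs.2

end Monotone

/-! ### Tangent cones and approach directions -/

section Cone

variable {X : Type*} [NormedAddCommGroup X] [NormedSpace ℝ X]

/-- The directions `v` for which some point `x + t • v` with `t > 0` lies in `U`: the cone generated by
`U - x`. -/
def enteringDirections (x : X) (U : Set X) : Set X :=
  {v | ∃ t : ℝ, 0 < t ∧ x + t • v ∈ U}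

theorem isOpen_enteringDirections {x : X} {U : Set X} (hU : IsOpen U) :
    IsOpen (enteringDirections x U) := by
  have : enteringDirections x U = ⋃ t ∈ Ioi (0 : ℝ), (fun v ↦ x + t • v) ⁻¹' U := by
    ext v; simp [enteringDirections]
  rw [this]
  exact isOpen_biUnion fun t _ ↦ hU.preimage (by fun_prop)

theorem convex_enteringDirections {x : X} {U : Set X} (hU : Convex ℝ U) :
    Convex ℝ (enteringDirections x U) := by
  rintro v ⟨s, hs, hv⟩ w ⟨t, ht, hw⟩ α β hα hβ hab
  -- The weights on `x + s • v` and `x + t • w` are proportional to `α / s` and `β / t`.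
  have hpos : 0 < α / s + β / t := by
    rcases hα.eq_or_lt with rfl | hα
    · obtain rfl : β = 1 := by linarith
      simpa using ht
    · positivity
  refine ⟨(α / s + β / t)⁻¹, by positivity, ?_⟩
  have h1 : (α / s + β / t)⁻¹ * (α / s) + (α / s + β / t)⁻¹ * (β / t) = 1 := by
    rw [← mul_add, inv_mul_cancel₀ hpos.ne']
  convert hU hv hw (a := (α / s + β / t)⁻¹ * (α / s)) (b := (α / s + β / t)⁻¹ * (β / t))
    (by positivity) (by positivity) h1 using 1
  have e1 : (α / s + β / t)⁻¹ * (α / s) * s = (α / s + β / t)⁻¹ * α := by field_simp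
  have e2 : (α / s + β / t)⁻¹ * (β / t) * t = (α / s + β / t)⁻¹ * β := by field_simp
  rw [smul_add, smul_add _ x, smul_add _ x, smul_smul, smul_smul, smul_smul, smul_smul, e1, e2,
    add_add_add_comm, ← add_smul, h1, one_smul]

theorem convexTangentCone_eq_closure_enteringDirections {x : X} {U S : Set X} (hUS : U ⊆ S)
    (hSU : S ⊆ closure U) : convexTangentCone x S = closure (enteringDirections x U) := by
  refine Subset.antisymm (closure_minimal ?_ isClosed_closure) (closure_mono ?_)
  · rintro _ ⟨t, ht, s, hs, rfl⟩
    refine map_mem_closure (f := fun y ↦ t⁻¹ • (y - x)) (by fun_prop) (hSU hs) fun y hy ↦ ?_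
    exact ⟨t, ht, by simpa [smul_smul, ht.ne'] using hy⟩
  · rintro v ⟨t, ht, hv⟩
    exact ⟨t, ht, _, hUS hv, by simp [smul_smul, ht.ne']⟩

theorem add_smul_mem_enteringDirections {x v e : X} {U : Set X} (hU : Convex ℝ U) (hUo : IsOpen U)
    (hv : v ∈ closure (enteringDirections x U)) (he : e ∈ enteringDirections x U) {s : ℝ}
    (hs : 0 < s) : v + s • e ∈ enteringDirections x U := by
  have h := (convex_enteringDirections (x := x) hU).combo_closure_interior_mem_interior hv
    (by rwa [(isOpen_enteringDirections hUo).interior_eq]) (a := (1 + s)⁻¹) (b := (1 + s)⁻¹ * s)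
    (by positivity) (by positivity) (by field_simp)
  obtain ⟨t, ht, hmem⟩ := interior_subset h
  refine ⟨t * (1 + s)⁻¹, by positivity, ?_⟩
  convert hmem using 2
  module

/-- An eventual property along `directionFilter D x v` is also eventual along
`directionFilter D x v'` for all directions `v'` near `v`. -/
theorem eventually_directionFilter_nhds {D : Set X} {x v : X} {P : X × ℝ → Prop}
    (h : ∀ᶠ p in directionFilter D x v, P p) :
    ∀ᶠ v' in 𝓝 v, ∀ᶠ p in directionFilter D x v', P p := by
  rw [directionFilter, eventually_inf_principal, eventually_prod_iff] at h
  obtain ⟨Q, hQ, R, hR, hQR⟩ := h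
  filter_upwards [hQ.eventually_nhds] with v' hv'
  rw [directionFilter, eventually_inf_principal, eventually_prod_iff]
  exact ⟨Q, hv', R, hR, hQR⟩

theorem exists_seq_of_neBot_directionFilter {D : Set X} {x v : X}
    (h : (directionFilter D x v).NeBot) :
    ∃ (w : ℕ → X) (t : ℕ → ℝ), Tendsto (fun n ↦ (w n, t n)) atTop (directionFilter D x v) ∧
      (∀ n, 0 < t n) ∧ ∀ n, x + t n • w n ∈ D := by
  have : (directionFilter D x v).IsCountablyGenerated := by
    unfold directionFilter; infer_instance
  obtain ⟨p, hp⟩ := exists_seq_tendsto (directionFilter D x v)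
  have hev : ∀ᶠ p in directionFilter D x v, 0 < p.2 ∧ x + p.2 • p.1 ∈ D := by
    rw [directionFilter, eventually_inf_principal]
    filter_upwards [tendsto_snd.eventually (self_mem_nhdsWithin (s := Ioi (0 : ℝ)) (a := 0))]
      with p h1 h2 using ⟨h1, h2⟩
  obtain ⟨N, hN⟩ := eventually_atTop.1 (hp.eventually hev)
  exact ⟨fun n ↦ (p (n + N)).1, fun n ↦ (p (n + N)).2, hp.comp (tendsto_add_atTop_nat N),
    fun n ↦ (hN (n + N) (by omega)).1, fun n ↦ (hN (n + N) (by omega)).2⟩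

theorem tendsto_fst_directionFilter (D : Set X) (x v : X) :
    Tendsto Prod.fst (directionFilter D x v) (𝓝 v) :=
  tendsto_fst.mono_left inf_le_left

theorem tendsto_snd_directionFilter (D : Set X) (x v : X) :
    Tendsto Prod.snd (directionFilter D x v) (𝓝[>] 0) :=
  tendsto_snd.mono_left inf_le_left

theorem tendsto_add_smul_of_tendsto {x v : X} {w : ℕ → X} {t : ℕ → ℝ}
    (hw : Tendsto w atTop (𝓝 v)) (ht : Tendsto t atTop (𝓝 0)) :
    Tendsto (fun n ↦ x + t n • w n) atTop (𝓝 x) := by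
  simpa using (ht.smul hw).const_add x

theorem IsMonotoneOperator.supportFun_le_liminf {A : X → Set (StrongDual ℝ X)}
    (hA : IsMonotoneOperator A) {D : Set X}
    (hD : D ⊆ operatorDomain A) {a : X → StrongDual ℝ X} (ha : IsSelection A a) (x v : X) :
    supportFun (A x) v ≤
      liminf (fun p : X × ℝ ↦ ((a (x + p.2 • p.1) p.1 : ℝ) : EReal)) (directionFilter D x v) := by
  refine iSup₂_le fun ζ hζ ↦ ?_
  refine le_of_forall_lt fun c hc ↦ ?_
  obtain ⟨c', hcc', hc'⟩ := exists_between hc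
  refine hcc'.trans_le (le_liminf_of_le (by isBoundedDefault) ?_)
  have hlim : Tendsto (fun p : X × ℝ ↦ ((ζ p.1 : ℝ) : EReal)) (directionFilter D x v)
      (𝓝 ((ζ v : ℝ) : EReal)) :=
    (continuous_coe_real_ereal.tendsto _).comp
      ((ζ.continuous.tendsto v).comp (tendsto_fst_directionFilter D x v))
  have hD' : ∀ᶠ p in directionFilter D x v, x + p.2 • p.1 ∈ D :=
    mem_inf_of_right (mem_principal_self _)
  filter_upwards [hlim.eventually (lt_mem_nhds hc'), hD',
    (tendsto_snd_directionFilter D x v).eventually self_mem_nhdsWithin] with p h1 h2 h3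
  exact h1.le.trans
    (EReal.coe_le_coe_iff.2 (hA.apply_le_apply_of_smul h3 hζ (ha _ (hD h2))))

end Cone

/-! ### Limits along directions -/

section Main

variable {X : Type*} [NormedAddCommGroup X] [NormedSpace ℝ X] [CompleteSpace X]
  {A : X → Set (StrongDual ℝ X)}

theorem IsMaximalMonotone.add_smul_mem_interior (hA : IsMaximalMonotone A) {x v : X}
    (hx : x ∈ operatorDomain A) {t₀ t : ℝ} (h : x + t₀ • v ∈ interior (operatorDomain A))
    (ht : 0 < t) (htt : t ≤ t₀) : x + t • v ∈ interior (operatorDomain A) := by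
  have ht₀ : 0 < t₀ := ht.trans_le htt
  convert hA.combo_mem_interior hx h (div_pos ht ht₀) ((div_le_one ht₀).2 htt) using 1
  rw [smul_add, smul_smul, div_mul_cancel₀ _ ht₀.ne', ← add_assoc, ← add_smul, sub_add_cancel,
    one_smul]

/-- If the ray from `x` in direction `v` meets the interior of the domain, then `A` is bounded on a
truncated cone around that ray. The bound at the interior point `x + t₀ • v` and any element of `A x`
control `η` from both ends of the ray, leaving only a bounded multiple of each small `u` free. -/
theorem IsMonotoneOperator.eventually_norm_le (hA : IsMonotoneOperator A) {x v : X}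
    (hx : x ∈ operatorDomain A) (hv : v ∈ enteringDirections x (interior (operatorDomain A)))
    (D : Set X) :
    ∃ C : ℝ, ∀ᶠ p in directionFilter D x v, ∀ η ∈ A (x + p.2 • p.1), ‖η‖ ≤ C := by
  obtain ⟨ξ, hξ⟩ := hx
  obtain ⟨t₀, ht₀, hmem⟩ := hv
  obtain ⟨r, hr, K, hball, hK⟩ := hA.exists_norm_le_of_mem_interior hmem
  have hK0 : 0 ≤ K := by
    obtain ⟨η, hη⟩ := hball (Metric.mem_ball_self hr)
    exact (norm_nonneg η).trans (hK _ (Metric.mem_ball_self hr) η hη)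
  refine ⟨(K * (t₀ * (‖v‖ + 1) + r / 2) + t₀ * (‖ξ‖ * (‖v‖ + 1))) / (r / 2), ?_⟩
  have h1 : ∀ᶠ w in 𝓝 v, x + t₀ • w ∈ Metric.ball (x + t₀ • v) (r / 2) :=
    (show Continuous fun w ↦ x + t₀ • w by fun_prop).continuousAt.eventually
      (Metric.ball_mem_nhds _ (half_pos hr))
  have h2 : ∀ᶠ w in 𝓝 v, ‖w‖ < ‖v‖ + 1 :=
    continuous_norm.continuousAt.eventually (gt_mem_nhds (lt_add_one _))
  filter_upwards [(tendsto_fst_directionFilter D x v).eventually (h1.and h2),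
    (tendsto_snd_directionFilter D x v).eventually (Ioo_mem_nhdsGT ht₀)]
  rintro ⟨w, t⟩ ⟨hw1, hw2⟩ ⟨ht, htt⟩ η hη
  simp only at hw1 hw2 ht htt hη
  rw [le_div_iff₀ (half_pos hr), mul_comm]
  refine mul_norm_le_of_forall_le η (half_pos hr) fun u hu ↦ ?_
  have hz : x + t₀ • w + u ∈ Metric.ball (x + t₀ • v) r := by
    rw [mem_ball_iff_norm] at hw1 ⊢
    rw [add_sub_right_comm]
    linarith [norm_add_le (x + t₀ • w - (x + t₀ • v)) u]
  obtain ⟨ζ, hζ⟩ := hball hz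
  have a1 := hA.apply_sub_le hζ hη
  have a2 := hA.apply_sub_le hη hξ
  have e : x + t₀ • w + u - (x + t • w) = (t₀ - t) • w + u := by module
  rw [e] at a1
  rw [add_sub_cancel_left, map_smul, map_smul, smul_eq_mul, smul_eq_mul,
    mul_le_mul_iff_right₀ ht] at a2
  have a3 : ζ ((t₀ - t) • w + u) ≤ K * (t₀ * (‖v‖ + 1) + r / 2) := by
    refine apply_le_of_norm_le ζ (hK _ hz ζ hζ) ((norm_add_le _ _).trans (add_le_add ?_ hu))
    rw [norm_smul, Real.norm_of_nonneg (by linarith)]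
    exact mul_le_mul (by linarith) hw2.le (norm_nonneg _) ht₀.le
  have a4 : ξ (-w) ≤ ‖ξ‖ * (‖v‖ + 1) :=
    apply_le_of_norm_le ξ le_rfl (by rw [norm_neg]; exact hw2.le)
  rw [map_neg] at a4
  rw [map_add, map_smul, smul_eq_mul] at a1
  have a5 : -((t₀ - t) * η w) ≤ t₀ * (‖ξ‖ * (‖v‖ + 1)) := by
    rw [← mul_neg]
    refine (mul_le_mul_of_nonneg_left (show -η w ≤ ‖ξ‖ * (‖v‖ + 1) by linarith)
      (by linarith)).trans (mul_le_mul_of_nonneg_right (by linarith) (by positivity))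
  linarith

theorem IsMaximalMonotone.directionFilter_neBot (hA : IsMaximalMonotone A) {x v : X}
    (hx : x ∈ operatorDomain A) (hv : v ∈ enteringDirections x (interior (operatorDomain A)))
    {D : Set X} (hdense : operatorDomain A ⊆ closure D) : (directionFilter D x v).NeBot := by
  obtain ⟨t₀, ht₀, hmem⟩ := hv
  rw [directionFilter, inf_principal_neBot_iff]
  intro N hN
  obtain ⟨V, hV, R, hR, hVR⟩ := mem_prod_iff.1 hN
  obtain ⟨t, htR, ht⟩ := Filter.nonempty_of_mem (inter_mem hR (Ioc_mem_nhdsGT ht₀))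
  have hcl := hdense (interior_subset (hA.add_smul_mem_interior hx hmem ht.1 ht.2))
  have hpre : (fun d ↦ t⁻¹ • (d - x)) ⁻¹' V ∈ 𝓝 (x + t • v) := by
    refine (show Continuous fun d ↦ t⁻¹ • (d - x) by fun_prop).continuousAt.preimage_mem_nhds ?_
    simpa [smul_smul, ht.1.ne'] using hV
  obtain ⟨d, hdV, hdD⟩ := mem_closure_iff_nhds.1 hcl _ hpre
  refine ⟨(t⁻¹ • (d - x), t), hVR ⟨hdV, htR⟩, ?_⟩
  simpa [smul_smul, ht.1.ne'] using hdD

/-- The graph of a maximal monotone operator is sequentially strong-to-weak-star closed. -/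
theorem IsMaximalMonotone.mem_of_tendsto (hA : IsMaximalMonotone A) {x : X} {y : ℕ → X}
    {η : ℕ → StrongDual ℝ X} {ξ : StrongDual ℝ X} (hy : Tendsto y atTop (𝓝 x))
    (hη : ∀ n, η n ∈ A (y n)) (hξ : ∀ u, Tendsto (fun n ↦ η n u) atTop (𝓝 (ξ u))) : ξ ∈ A x := by
  refine hA.mem_of_forall_nonneg fun z ζ hζ ↦ ?_
  have hyz : Tendsto (fun n ↦ y n - z) atTop (𝓝 (x - z)) := hy.sub_const z
  have hlim := (tendsto_apply_of_forall_tendsto hξ hyz).sub ((ζ.continuous.tendsto _).comp hyz)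
  exact ge_of_tendsto' hlim fun n ↦ hA.1 (y n) z (η n) (hη n) ζ hζ

/-- Any weak-star limit of values of `A` along directions tending to `v` belongs to `A x` and
maximizes the pairing with `v` there. -/
theorem IsMaximalMonotone.supportFun_eq_of_tendsto (hA : IsMaximalMonotone A) {x v : X} {w : ℕ → X}
    {t : ℕ → ℝ} (hw : Tendsto w atTop (𝓝 v)) (ht0 : ∀ n, 0 < t n) (ht : Tendsto t atTop (𝓝 0))
    {η : ℕ → StrongDual ℝ X} {ξ : StrongDual ℝ X} (hη : ∀ n, η n ∈ A (x + t n • w n))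
    (hξ : ∀ u, Tendsto (fun n ↦ η n u) atTop (𝓝 (ξ u))) :
    supportFun (A x) v = ((ξ v : ℝ) : EReal) := by
  refine le_antisymm (iSup₂_le fun ζ hζ ↦ EReal.coe_le_coe_iff.2 ?_)
    (le_iSup₂ (f := fun (ζ : StrongDual ℝ X) (_ : ζ ∈ A x) ↦ ((ζ v : ℝ) : EReal)) ξ
      (hA.mem_of_tendsto (tendsto_add_smul_of_tendsto hw ht) hη hξ))
  exact le_of_tendsto_of_tendsto' ((ζ.continuous.tendsto v).comp hw)
    (tendsto_apply_of_forall_tendsto hξ hw)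
    fun n ↦ hA.1.apply_le_apply_of_smul (ht0 n) hζ (hη n)

theorem IsMaximalMonotone.exists_seq_tendsto (hX : IsReflexiveSpace X)
    (hA : IsMaximalMonotone A) {D : Set X} (hD : D ⊆ operatorDomain A)
    (hdense : operatorDomain A ⊆ closure D) {a : X → StrongDual ℝ X} (ha : IsSelection A a)
    {x v : X} (hx : x ∈ operatorDomain A)
    (hv : v ∈ enteringDirections x (interior (operatorDomain A))) :
    ∃ (w : ℕ → X) (t : ℕ → ℝ) (ξ : StrongDual ℝ X),
      Tendsto (fun n ↦ (w n, t n)) atTop (directionFilter D x v) ∧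
      (∀ n, 0 < t n) ∧ (∀ n, x + t n • w n ∈ D) ∧
      ∀ u, Tendsto (fun n ↦ a (x + t n • w n) u) atTop (𝓝 (ξ u)) := by
  obtain ⟨w, t, hwt, ht, hwD⟩ :=
    exists_seq_of_neBot_directionFilter (hA.directionFilter_neBot hx hv hdense)
  obtain ⟨C, hC⟩ := hA.1.eventually_norm_le hx hv D
  obtain ⟨N, hN⟩ := eventually_atTop.1 (hwt.eventually hC)
  obtain ⟨ξ, φ, hφ, hξ⟩ := hX.exists_subseq_tendsto_apply
    (fun n ↦ a (x + t (n + N) • w (n + N))) (C := C)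
    fun n ↦ hN (n + N) (by omega) _ (ha _ (hD (hwD _)))
  exact ⟨fun n ↦ w (φ n + N), fun n ↦ t (φ n + N), ξ,
    hwt.comp ((tendsto_add_atTop_nat N).comp hφ.tendsto_atTop), fun n ↦ ht _, fun n ↦ hwD _, hξ⟩

/-- The upper bound for the lower limit, on the whole tangent cone. A direction `v` of the tangent
cone is the limit of directions `v + s • e` into the interior of the domain, along which a weak limit
`ξ ∈ A x` exists with `ξ (v + s • e) ≤ σ v + s * σ e`, where `σ` is the support function of `A x` and
`σ e` is finite. -/
theorem IsMaximalMonotone.liminf_le_supportFun (hX : IsReflexiveSpace X)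
    (hA : IsMaximalMonotone A) (hint : (interior (operatorDomain A)).Nonempty)
    {D : Set X} (hD : D ⊆ operatorDomain A)
    (hdense : operatorDomain A ⊆ closure D) {a : X → StrongDual ℝ X} (ha : IsSelection A a)
    {x v : X} (hx : x ∈ operatorDomain A)
    (hv : v ∈ closure (enteringDirections x (interior (operatorDomain A)))) :
    liminf (fun p : X × ℝ ↦ ((a (x + p.2 • p.1) p.1 : ℝ) : EReal)) (directionFilter D x v) ≤
      supportFun (A x) v := by
  refine le_of_forall_gt fun c hc ↦ ?_
  obtain ⟨b, hvb, hbc⟩ := EReal.exists_between_coe_real hc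
  obtain ⟨b', hvb', hbb'⟩ := EReal.exists_between_coe_real hvb
  refine lt_of_le_of_lt (liminf_le_of_frequently_le' ?_) hbc
  intro hev
  obtain ⟨y, hy⟩ := hint
  -- Any direction into the interior serves as the auxiliary direction `e`.
  have he : y - x ∈ enteringDirections x (interior (operatorDomain A)) :=
    ⟨1, one_pos, by simpa using hy⟩
  set e := y - x
  obtain ⟨we, te, ξe, hwte, hte, hweD, hξe⟩ := hA.exists_seq_tendsto hX hD hdense ha hx he
  have hσe := hA.supportFun_eq_of_tendsto ((tendsto_fst_directionFilter D x e).comp hwte) hte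
    (((tendsto_snd_directionFilter D x e).mono_right nhdsWithin_le_nhds).comp hwte)
    (fun n ↦ ha _ (hD (hweD n))) hξe
  have hpath : Tendsto (fun s : ℝ ↦ v + s • e) (𝓝[>] 0) (𝓝 v) := by
    have : Continuous fun s : ℝ ↦ v + s • e := by fun_prop
    simpa using (this.tendsto 0).mono_left nhdsWithin_le_nhds
  have hval : ∀ᶠ s : ℝ in 𝓝[>] 0, b' + s * ξe e < b := by
    have : Continuous fun s : ℝ ↦ b' + s * ξe e := by fun_prop
    refine ((this.tendsto 0).mono_left nhdsWithin_le_nhds).eventually (gt_mem_nhds ?_)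
    simpa using hbb'
  -- Choose `s > 0` so small that the direction `v + s • e` inherits the assumed eventual lower bound `b`,
  -- while `b' + s * σ e` is still below `b`.
  obtain ⟨s, hs, hsv, hs0⟩ := ((hpath.eventually (eventually_directionFilter_nhds hev)).and
    (hval.and self_mem_nhdsWithin)).exists
  have hvs := add_smul_mem_enteringDirections hA.convex_interior_operatorDomain isOpen_interior
    hv he hs0
  obtain ⟨w, t, ξ, hwt, ht, hwD, hξ⟩ := hA.exists_seq_tendsto hX hD hdense ha hx hvs
  have hw := (tendsto_fst_directionFilter D x _).comp hwt
  have ht' := ((tendsto_snd_directionFilter D x _).mono_right nhdsWithin_le_nhds).comp hwt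
  have hξA : ξ ∈ A x := hA.mem_of_tendsto (tendsto_add_smul_of_tendsto hw ht')
    (fun n ↦ ha _ (hD (hwD n))) hξ
  have hle : ∀ u, ((ξ u : ℝ) : EReal) ≤ supportFun (A x) u := fun u ↦
    le_iSup₂ (f := fun (ζ : StrongDual ℝ X) (_ : ζ ∈ A x) ↦ ((ζ u : ℝ) : EReal)) ξ hξA
  have h1 : ξ v < b' := EReal.coe_lt_coe_iff.1 ((hle v).trans_lt hvb')
  have h2 : ξ e ≤ ξe e := EReal.coe_le_coe_iff.1 ((hle e).trans_eq hσe)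
  have h3 : b ≤ ξ (v + s • e) := by
    refine ge_of_tendsto (tendsto_apply_of_forall_tendsto hξ hw) ?_
    filter_upwards [hwt.eventually hs] with n hn
    exact (EReal.coe_lt_coe_iff.1 (not_le.1 hn)).le
  rw [map_add, map_smul, smul_eq_mul] at h3
  have := mul_le_mul_of_nonneg_left h2 (le_of_lt (show (0 : ℝ) < s from hs0))
  linarith

end Main

theorem mainTheorem6 {X : Type*} [NormedAddCommGroup X] [NormedSpace ℝ X] [CompleteSpace X]
    (hX : IsReflexiveSpace X)
    (A : X → Set (StrongDual ℝ X)) (hA : IsMaximalMonotone A)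
    (hint : (interior (operatorDomain A)).Nonempty)
    (D : Set X) (hD : D ⊆ operatorDomain A) (hdense : operatorDomain A ⊆ closure D)
    (a : X → StrongDual ℝ X) (ha : IsSelection A a)
    (x : X) (hx : x ∈ operatorDomain A) (v : X) (hv : v ≠ 0) :
    (v ∈ interior (convexTangentCone x (closure (operatorDomain A))) →
      (weakLimsup a D x v).Nonempty ∧
        ∀ ξ ∈ weakLimsup a D x v, supportFun (A x) v = ((ξ v : ℝ) : EReal)) ∧
    (v ∈ frontier (convexTangentCone x (closure (operatorDomain A))) →
      supportFun (A x) v =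
        Filter.liminf (fun p : X × ℝ => ((a (x + p.2 • p.1) p.1 : ℝ) : EReal))
          (directionFilter D x v)) ∧
    (v ∉ interior (convexTangentCone x (closure (operatorDomain A))) →
      v ∉ frontier (convexTangentCone x (closure (operatorDomain A))) →
      supportFun (A x) v = ⊤) := by
  set U := interior (operatorDomain A) with hU
  have hUconv : Convex ℝ U := hA.convex_interior_operatorDomain
  have hcone : convexTangentCone x (closure (operatorDomain A)) =
      closure (enteringDirections x U) :=
    convexTangentCone_eq_closure_enteringDirections (interior_subset.trans subset_closure)
      (closure_minimal (hA.operatorDomain_subset_closure_interior hint) isClosed_closure)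
  have hKconv := convex_enteringDirections (x := x) hUconv
  have hKopen : IsOpen (enteringDirections x U) := isOpen_enteringDirections isOpen_interior
  refine ⟨fun hvi ↦ ?_, fun hvb ↦ ?_, fun hni hnb ↦ ?_⟩
  · have hvK : v ∈ enteringDirections x U := by
      have hne : (interior (enteringDirections x U)).Nonempty := by
        obtain ⟨y, hy⟩ := hint
        rw [hKopen.interior_eq]
        exact ⟨y - x, 1, one_pos, by simpa using hy⟩
      rwa [hcone, hKconv.interior_closure_eq_interior_of_nonempty_interior hne,
        hKopen.interior_eq] at hvi
    constructor
    · obtain ⟨w, t, ξ, hwt, ht, hwD, hξ⟩ := hA.exists_seq_tendsto hX hD hdense ha hx hvK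
      exact ⟨ξ, w, t, (tendsto_fst_directionFilter D x v).comp hwt, ht,
        ((tendsto_snd_directionFilter D x v).mono_right nhdsWithin_le_nhds).comp hwt, hwD,
        hX.tendsto_toWeakSpace_iff.2 hξ⟩
    · rintro ξ ⟨w, t, hw, ht0, ht, hwD, hξ⟩
      exact hA.supportFun_eq_of_tendsto hw ht0 ht (fun n ↦ ha _ (hD (hwD n)))
        (hX.tendsto_toWeakSpace_iff.1 hξ)
  · refine le_antisymm (hA.1.supportFun_le_liminf hD ha x v)
      (hA.liminf_le_supportFun hX hint hD hdense ha hx ?_)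
    rw [← closure_closure, ← hcone]
    exact frontier_subset_closure hvb
  · refine hA.supportFun_eq_top hx (hcone ▸ hKconv.closure) fun hvT ↦ ?_
    exact hnb ⟨subset_closure hvT, hni⟩
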